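/- **Setting.** An instance of the strategic knapsack problem consists of a number $n\ge 1$ of agents, a finite set $E$ of items partitioned into sets $E_1,\dots,E_n$ ($E_a$ is owned by agent $a$), values $v_i>0$ and sizes $s_i>0$ for $i\in E$, and a capacity $C>0$. For $D\subseteq E$ write $v(D)=\sum_{i\in D}v_i$, $s(D)=\sum_{i\in D}s_i$, $D_a=D\cap E_a$ and $v_a(D)=v(D_a)$. As standing conventions, $s_i\le C$ for all $i\in E$; distinct items have distinct values and distinct sizes; and for all $E'\subseteq E$ and $0\le C'\le C$ the set of maximizers of $v(D)$ over $D\subseteq E'$ with $s(D)\le C'$ is a singleton. Let $\mathrm{Opt}(E')$ be the maximizer for $C'=C$. An instance is unit-density if $v_i/s_i=1$ for all $i\in E$; $\mathcal I_{\mathrm{UD}}$ is the set of these instances. A deterministic (randomized) mechanism maps every instance to a set (a random set) $M(E)\subseteq E$ with $s(M(E))\le C$. A deterministic mechanism is strategyproof on $\mathcal I_{\mathrm{UD}}$ if for every instance in $\mathcal I_{\mathrm{UD}}$, every agent $a$ and every $E'\subseteq E$ with $E\setminus E'\subseteq E_a$ one has $v_a(M(E))\ge v_a(M(E'))$, where the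 instance with items $E'$ keeps all other data. A randomized mechanism is strategyproof on $\mathcal I_{\mathrm{UD}}$ if it is a lottery over deterministic mechanisms that are strategyproof on $\mathcal I_{\mathrm{UD}}$. It is $\alpha$-approximate on $\mathcal I_{\mathrm{UD}}$ if $\mathbb E[v(M(E))]\ge\alpha\, v(\mathrm{Opt}(E))$ for every instance in $\mathcal I_{\mathrm{UD}}$. For $Q\subseteq E$ let $x(Q)\in[0,1]^Q$ be the fractional greedy solution: items of $Q$ are taken in order of decreasing density $v_i/s_i$ (ties in favour of larger value) and get $x_i(Q)=1$ as long as they fully fit into capacity $C$; the first item that does not fit fills the remaining capacity fractionally; all later items get $0$. $\textsc{RestrictedGreedy}(E,Q)$ returns $\bigcup_a E^*_a$, where $E^*_a$ maximizes $v(E')$ over $E'\subseteq E_a$ with $v(E')\le\sum_{i\in Q_a}v_i\,x_i(Q)$. $\textsc{FitTwo}$ with parameter $\beta$: if $\max_a v(\mathrm{Opt}(E_a))\ge\beta C$, return $\mathrm{Opt}(E_{a'})$ for an agent $a'$ attaining this maximum. Otherwise let $P$ be the set of items $i$ such that $v_i+v_j\le C$ for every item $j$ of another agent with $v_j<v_i$,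 let $i^*$ be the most valuable item of $P$, let $R=\{i^*\}\cup\{i\in E: v_{i^*}+v_i\le C\}$, and return $\textsc{RestrictedGreedy}(E,R)$. $\textsc{LargeFit}$: if $\max_a v(\mathrm{Opt}(E_a))\ge\frac23C$, return $\mathrm{Opt}(E_{a'})$ for an agent $a'$ attaining this maximum. Otherwise let $j^*$ be the most valuable item of $E$ and $b^*$ its owner, let $S=E_{b^*}\cup\{i\in E\setminus E_{b^*}: v_{j^*}+v_i\le C\}$, and return $\textsc{RestrictedGreedy}(E,S)$. (If $E=\emptyset$, the output of each is $\emptyset$.) **Theorem.** There is a randomized mechanism that is strategyproof and $\frac23$-approximate on $\mathcal I_{\mathrm{UD}}$ and that, on every instance in $\mathcal I_{\mathrm{UD}}$, returns the output of $\textsc{FitTwo}$ with $\beta=\frac23$ with probability $\frac23$ and the output of $\textsc{LargeFit}$ with probability $\frac13$. -/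

import Mathlib

namespace StrategicKnapsack

universe u

/-- An item of a strategic knapsack instance, with its owner, value and size attached to it. The
label only serves to tell items apart. -/
structure Item (ι : Type u) where
  label : ι
  owner : ℕ
  value : ℝ
  size : ℝ

noncomputable instance instDecidableEqItem {ι : Type u} : DecidableEq (Item ι) :=
  Classical.decEq _

/-- `v(D)`, the total value of a set of items. -/
noncomputable def totalValue {ι : Type u} (D : Finset (Item ι)) : ℝ := ∑ i ∈ D, i.value

/-- `s(D)`, the total size of a set of items. -/
noncomputable def totalSize {ι : Type u} (D : Finset (Item ι)) : ℝ := ∑ i ∈ D, i.size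

/-- `D_a`, the items of `D` that are owned by agent `a`. -/
def ownedBy {ι : Type u} (a : ℕ) (D : Finset (Item ι)) : Finset (Item ι) :=
  D.filter (fun i => i.owner = a)

/-- `D` is an optimal solution of the knapsack problem with items `E` and capacity `C`. -/
def IsOptimal {ι : Type u} (E : Finset (Item ι)) (C : ℝ) (D : Finset (Item ι)) : Prop :=
  (D ⊆ E ∧ totalSize D ≤ C) ∧
    ∀ D' : Finset (Item ι), D' ⊆ E → totalSize D' ≤ C → totalValue D' ≤ totalValue D

/-- An instance of the strategic knapsack problem with agents `1, …, n`, subject to the standing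
conventions: no item exceeds the capacity, distinct items have distinct values and distinct sizes,
and every reduced knapsack problem has a unique optimal solution. -/
structure KnapsackInstance (ι : Type u) where
  n : ℕ
  n_pos : 0 < n
  items : Finset (Item ι)
  capacity : ℝ
  capacity_pos : 0 < capacity
  owner_mem : ∀ i ∈ items, i.owner ∈ Finset.Icc 1 n
  value_pos : ∀ i ∈ items, 0 < i.value
  size_pos : ∀ i ∈ items, 0 < i.size
  size_le_capacity : ∀ i ∈ items, i.size ≤ capacity
  value_ne : ∀ i ∈ items, ∀ j ∈ items, i ≠ j → i.value ≠ j.value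
  size_ne : ∀ i ∈ items, ∀ j ∈ items, i ≠ j → i.size ≠ j.size
  unique_optimal : ∀ E' : Finset (Item ι), E' ⊆ items → ∀ C' : ℝ, 0 ≤ C' → C' ≤ capacity →
    ∃! D : Finset (Item ι), IsOptimal E' C' D

/-- The instance that remains when only the items in `E'` are reported. -/
def KnapsackInstance.restrict {ι : Type u} (I : KnapsackInstance ι) (E' : Finset (Item ι))
    (h : E' ⊆ I.items) : KnapsackInstance ι where
  n := I.n
  n_pos := I.n_pos
  items := E'
  capacity := I.capacity
  capacity_pos := I.capacity_pos
  owner_mem := fun i hi => I.owner_mem i (h hi)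
  value_pos := fun i hi => I.value_pos i (h hi)
  size_pos := fun i hi => I.size_pos i (h hi)
  size_le_capacity := fun i hi => I.size_le_capacity i (h hi)
  value_ne := fun i hi j hj => I.value_ne i (h hi) j (h hj)
  size_ne := fun i hi j hj => I.size_ne i (h hi) j (h hj)
  unique_optimal := fun E'' hE'' => I.unique_optimal E'' (hE''.trans h)

/-- The set of unit-density instances: every item has density `v_i / s_i = 1`. -/
def unitDensity (ι : Type u) : Set (KnapsackInstance ι) :=
  {I | ∀ i ∈ I.items, i.value / i.size = 1}

/-- A member of the family `𝓓` of maximum total value. -/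
noncomputable def mostValuable {ι : Type u} (𝓓 : Finset (Finset (Item ι))) : Finset (Item ι) :=
  if h : 𝓓.Nonempty then Classical.choose (𝓓.exists_max_image totalValue h) else ∅

/-- `Opt(E)` for capacity `C`. -/
noncomputable def opt {ι : Type u} (E : Finset (Item ι)) (C : ℝ) : Finset (Item ι) :=
  mostValuable (E.powerset.filter (fun D => totalSize D ≤ C))

/-! ### Mechanisms -/

/-- A deterministic mechanism maps every instance to a feasible set of (reported) items. -/
structure DeterministicMechanism (ι : Type u) where
  output : KnapsackInstance ι → Finset (Item ι)
  feasible : ∀ I : KnapsackInstance ι, output I ⊆ I.items ∧ totalSize (output I) ≤ I.capacity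

/-- No agent `a` can increase the value of their own packed items by hiding own items. -/
def DeterministicMechanism.StrategyproofOn {ι : Type u} (M : DeterministicMechanism ι)
    (𝓘 : Set (KnapsackInstance ι)) : Prop :=
  ∀ I ∈ 𝓘, ∀ a ∈ Finset.Icc 1 I.n, ∀ (E' : Finset (Item ι)) (h : E' ⊆ I.items),
    I.items \ E' ⊆ ownedBy a I.items →
      totalValue (ownedBy a (M.output (I.restrict E' h))) ≤ totalValue (ownedBy a (M.output I))

/-- A randomized mechanism maps every instance to a probability distribution on its feasible sets
of items. -/
structure RandomizedMechanism (ι : Type u) where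
  law : KnapsackInstance ι → PMF (Finset (Item ι))
  feasible : ∀ (I : KnapsackInstance ι), ∀ D ∈ (law I).support,
    D ⊆ I.items ∧ totalSize D ≤ I.capacity

/-- Universal strategyproofness: the mechanism is a lottery over strategyproof deterministic
mechanisms. -/
def RandomizedMechanism.StrategyproofOn {ι : Type u} (M : RandomizedMechanism ι)
    (𝓘 : Set (KnapsackInstance ι)) : Prop :=
  ∃ L : PMF (DeterministicMechanism ι),
    (∀ F ∈ L.support, F.StrategyproofOn 𝓘) ∧
      ∀ I : KnapsackInstance ι, M.law I = L.map (fun F => F.output I)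

/-- The expected total value of the packed items; the sum runs over all subsets of the item set,
which contain the support of the distribution. -/
noncomputable def RandomizedMechanism.expectedValue {ι : Type u} (M : RandomizedMechanism ι)
    (I : KnapsackInstance ι) : ℝ :=
  ∑ D ∈ I.items.powerset, (M.law I D).toReal * totalValue D

/-- The mechanism obtains, in expectation, at least an `α`-fraction of the optimal value. -/
def RandomizedMechanism.ApproximateOn {ι : Type u} (M : RandomizedMechanism ι) (α : ℝ)
    (𝓘 : Set (KnapsackInstance ι)) : Prop :=
  ∀ I ∈ 𝓘, α * totalValue (opt I.items I.capacity) ≤ M.expectedValue I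

/-! ### The fractional greedy solution -/

/-- `j` comes before `i` in the greedy order: decreasing density, ties in favour of larger
values. -/
def Precedes {ι : Type u} (j i : Item ι) : Prop :=
  i.value / i.size < j.value / j.size ∨
    (j.value / j.size = i.value / i.size ∧ i.value < j.value)

open scoped Classical in
/-- The total size of the items of `Q` that come before `i` in the greedy order. -/
noncomputable def sizeBefore {ι : Type u} (Q : Finset (Item ι)) (i : Item ι) : ℝ :=
  totalSize (Q.filter (fun j => Precedes j i))

/-- The fractional greedy solution `x_i(Q)` for capacity `C`: items are packed in greedy order as
long as they fully fit, the first item that does not fully fit is packed fractionally into the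
remaining capacity, and all later items are not packed. -/
noncomputable def fractionalGreedy {ι : Type u} (Q : Finset (Item ι)) (C : ℝ) (i : Item ι) : ℝ :=
  if sizeBefore Q i + i.size ≤ C then 1
  else if sizeBefore Q i ≤ C then (C - sizeBefore Q i) / i.size
  else 0

/-! ### The mechanisms FitTwo, LargeFit and RandomizedFit -/

/-- `RestrictedGreedy`: every agent `a` gets as quota the value of their items in the fractional
greedy solution for the restricted set `Q`, and packs the best subset of all their items in `E`
whose value respects that quota. -/
noncomputable def restrictedGreedy {ι : Type u} (n : ℕ) (E Q : Finset (Item ι)) (C : ℝ) :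
    Finset (Item ι) :=
  (Finset.Icc 1 n).biUnion fun a =>
    mostValuable ((ownedBy a E).powerset.filter
      (fun D => totalValue D ≤ ∑ i ∈ ownedBy a Q, i.value * fractionalGreedy Q C i))

/-- An agent whose individual optimum has maximum value. -/
noncomputable def bestAgent {ι : Type u} (I : KnapsackInstance ι) : ℕ :=
  Classical.choose ((Finset.Icc 1 I.n).exists_max_image
    (fun a => totalValue (opt (ownedBy a I.items) I.capacity))
    (Finset.nonempty_Icc.mpr I.n_pos))

/-- The best individual optimum. -/
noncomputable def bestIndividual {ι : Type u} (I : KnapsackInstance ι) : Finset (Item ι) :=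
  opt (ownedBy (bestAgent I) I.items) I.capacity

open scoped Classical in
/-- The set `P` of the items that fit together with every less valuable item of any other agent. -/
noncomputable def fitSet {ι : Type u} (I : KnapsackInstance ι) : Finset (Item ι) :=
  I.items.filter (fun i => ∀ j ∈ I.items, j.owner ≠ i.owner → j.value < i.value →
    i.value + j.value ≤ I.capacity)

/-- The restricted set `R`: the most valuable item `i*` of `P`, and all items that fit together
with it. (`P` is empty only if there are no items at all.) -/
noncomputable def restrictedSet {ι : Type u} (I : KnapsackInstance ι) : Finset (Item ι) :=
  if h : (fitSet I).Nonempty then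
    let iStar := Classical.choose ((fitSet I).exists_max_image Item.value h)
    {iStar} ∪ I.items.filter (fun i => iStar.value + i.value ≤ I.capacity)
  else ∅

/-- `FitTwo` with parameter `β`. -/
noncomputable def fitTwo {ι : Type u} (β : ℝ) (I : KnapsackInstance ι) : Finset (Item ι) :=
  if β * I.capacity ≤ totalValue (bestIndividual I) then bestIndividual I
  else restrictedGreedy I.n I.items (restrictedSet I) I.capacity

/-- The restricted set `S`: all items of the owner of the most valuable item `j*`, and all items of
other agents that fit together with `j*`. -/
noncomputable def largeSet {ι : Type u} (I : KnapsackInstance ι) : Finset (Item ι) :=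
  if h : I.items.Nonempty then
    let jStar := Classical.choose (I.items.exists_max_image Item.value h)
    ownedBy jStar.owner I.items ∪
      (I.items \ ownedBy jStar.owner I.items).filter
        (fun i => jStar.value + i.value ≤ I.capacity)
  else ∅

/-- `LargeFit`. -/
noncomputable def largeFit {ι : Type u} (I : KnapsackInstance ι) : Finset (Item ι) :=
  if 2 / 3 * I.capacity ≤ totalValue (bestIndividual I) then bestIndividual I
  else restrictedGreedy I.n I.items (largeSet I) I.capacity

open scoped ENNReal in
/-- The two probabilities of the biased coin add up to one. -/
theorem coin_sum : ∑ b : Bool, (cond b (2 / 3) (1 / 3) : ℝ≥0∞) = 1 := by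
  simp only [Fintype.sum_bool, cond_true, cond_false]
  rw [ENNReal.div_add_div_same]
  have h : (2 + 1 : ℝ≥0∞) = 3 := by norm_num
  rw [h]
  exact ENNReal.div_self (by norm_num) (by norm_num)

/-- The Bernoulli distribution with success probability `2/3`. -/
noncomputable def coin : PMF Bool :=
  PMF.ofFintype (fun b => cond b (2 / 3) (1 / 3)) coin_sum

/-- `RandomizedFit`: with probability `2/3` return the output of `FitTwo` with parameter `2/3`,
otherwise the output of `LargeFit`. -/
noncomputable def randomizedFit {ι : Type u} (I : KnapsackInstance ι) : PMF (Finset (Item ι)) :=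
  coin.map (fun X => if X = true then fitTwo (2 / 3) I else largeFit I)

end StrategicKnapsack

namespace StrategicKnapsack

/-! At unit density the greedy solution fills the capacity with the items of `Q` by decreasing
value. An item then receives the capacity left by the more valuable ones, capped by its own value
(`packedValue`), and these amounts add up to min(v(Q), C) (`sum_packedValue`).

Strategyproofness. If some bundle reaches 2C/3, its owner already gets the best possible, and
another agent can take over only through a tie, which unique optima exclude. Below the threshold,
hiding items of `a` either does not raise the quota of `a`, or some own item `t` separates the new
quota q' from the old quota q, q' ≤ v(t) ≤ q, so that `t` alone is as good as anything obtained by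
hiding. The threshold enters because two items of one agent that fit together cannot both exceed C/3
(`pair_lt`). See `bestBundle_compatible_le` and `bestBundle_ownOrCompatible_le`.

Approximation. `two_mul_totalValue_le` shows 2 v(O) ≤ 2 FitTwo + LargeFit below the threshold, where
LargeFit obtains at least the top item `j`. If all of R is packed, O gains over R at most by
replacing i* with one item, a gain of at most v(j)/2. If not, the fully packed items before the
first cut item are valuable enough, together with `j`. -/

variable {ι : Type*}

/-! ### Unit-density items and the greedy quota -/

/-- The items of `Q` have positive, pairwise distinct values, and unit density. -/
structure UnitItems (Q : Finset (Item ι)) : Prop where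
  pos : ∀ i ∈ Q, 0 < i.value
  size_eq : ∀ i ∈ Q, i.size = i.value
  inj : ∀ i ∈ Q, ∀ j ∈ Q, i.value = j.value → i = j

theorem UnitItems.mono {Q Q' : Finset (Item ι)} (hQ : UnitItems Q) (h : Q' ⊆ Q) :
    UnitItems Q' :=
  ⟨fun i hi => hQ.pos i (h hi), fun i hi => hQ.size_eq i (h hi),
    fun i hi j hj => hQ.inj i (h hi) j (h hj)⟩

/-- The total value of the items of `Q` that are worth more than `t`. -/
noncomputable def valueAbove (Q : Finset (Item ι)) (t : ℝ) : ℝ :=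
  totalValue (Q.filter (fun j => t < j.value))

/-- The value of the packed part of `i`, when capacity `C` is filled with the items of `Q` in
order of decreasing value. -/
noncomputable def packedValue (Q : Finset (Item ι)) (C : ℝ) (i : Item ι) : ℝ :=
  min i.value (max 0 (C - valueAbove Q i.value))

/-- The value that agent `a` receives in the fractional greedy solution. -/
noncomputable def quota (a : ℕ) (Q : Finset (Item ι)) (C : ℝ) : ℝ :=
  ∑ i ∈ ownedBy a Q, packedValue Q C i

theorem mem_ownedBy {a : ℕ} {Q : Finset (Item ι)} {i : Item ι} :
    i ∈ ownedBy a Q ↔ i ∈ Q ∧ i.owner = a := Finset.mem_filter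

theorem ownedBy_subset (a : ℕ) (Q : Finset (Item ι)) : ownedBy a Q ⊆ Q :=
  Finset.filter_subset _ _

theorem ownedBy_mono (a : ℕ) {Q Q' : Finset (Item ι)} (h : Q' ⊆ Q) :
    ownedBy a Q' ⊆ ownedBy a Q :=
  Finset.filter_subset_filter _ h

theorem UnitItems.totalSize_eq {Q : Finset (Item ι)} (hQ : UnitItems Q) :
    totalSize Q = totalValue Q :=
  Finset.sum_congr rfl hQ.size_eq

theorem UnitItems.totalValue_nonneg {Q : Finset (Item ι)} (hQ : UnitItems Q) :
    0 ≤ totalValue Q :=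
  Finset.sum_nonneg fun i hi => (hQ.pos i hi).le

theorem UnitItems.totalValue_mono {Q Q' : Finset (Item ι)} (hQ : UnitItems Q) (h : Q' ⊆ Q) :
    totalValue Q' ≤ totalValue Q :=
  Finset.sum_le_sum_of_subset_of_nonneg h fun i hi _ => (hQ.pos i hi).le

theorem UnitItems.valueAbove_mono {Q Q' : Finset (Item ι)} (hQ : UnitItems Q) (h : Q' ⊆ Q)
    (t : ℝ) : valueAbove Q' t ≤ valueAbove Q t :=
  (hQ.mono (Finset.filter_subset _ _)).totalValue_mono (Finset.filter_subset_filter _ h)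

theorem UnitItems.valueAbove_zero {Q : Finset (Item ι)} (hQ : UnitItems Q) :
    valueAbove Q 0 = totalValue Q := by
  rw [valueAbove, Finset.filter_true_of_mem hQ.pos]

open scoped Classical in
theorem UnitItems.sizeBefore_eq {Q : Finset (Item ι)} (hQ : UnitItems Q) {i : Item ι}
    (hi : i ∈ Q) : sizeBefore Q i = valueAbove Q i.value := by
  have hd : ∀ j ∈ Q, j.value / j.size = 1 := fun j hj => by
    rw [hQ.size_eq j hj, div_self (hQ.pos j hj).ne']
  have hsize : ∀ F ⊆ Q, totalSize F = totalValue F := fun F hF => (hQ.mono hF).totalSize_eq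
  rw [sizeBefore, valueAbove, hsize _ (Finset.filter_subset _ _)]
  congr 1
  ext j
  simp only [Finset.mem_filter]
  refine and_congr_right fun hj => ?_
  simp [Precedes, hd i hi, hd j hj]

theorem UnitItems.value_mul_fractionalGreedy {Q : Finset (Item ι)} (hQ : UnitItems Q) (C : ℝ)
    {i : Item ι} (hi : i ∈ Q) :
    i.value * fractionalGreedy Q C i = packedValue Q C i := by
  have hpos := hQ.pos i hi
  rw [fractionalGreedy, packedValue, hQ.sizeBefore_eq hi, hQ.size_eq i hi]
  split_ifs with h1 h2
  · rw [min_eq_left (le_max_of_le_right (by linarith)), mul_one]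
  · rw [max_eq_right (by linarith), min_eq_right (by linarith), mul_div_cancel₀ _ hpos.ne']
  · rw [max_eq_left (by linarith), min_eq_right hpos.le, mul_zero]

theorem UnitItems.sum_eq_quota {Q : Finset (Item ι)} (hQ : UnitItems Q) (a : ℕ) (C : ℝ) :
    ∑ i ∈ ownedBy a Q, i.value * fractionalGreedy Q C i = quota a Q C :=
  Finset.sum_congr rfl fun _ hi => hQ.value_mul_fractionalGreedy C (ownedBy_subset a Q hi)

theorem UnitItems.packedValue_nonneg {Q : Finset (Item ι)} (hQ : UnitItems Q) (C : ℝ)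
    {i : Item ι} (hi : i ∈ Q) : 0 ≤ packedValue Q C i :=
  le_min (hQ.pos i hi).le (le_max_left _ _)

theorem UnitItems.quota_nonneg {Q : Finset (Item ι)} (hQ : UnitItems Q) (a : ℕ) (C : ℝ) :
    0 ≤ quota a Q C :=
  Finset.sum_nonneg fun _ hi => hQ.packedValue_nonneg C (ownedBy_subset a Q hi)

theorem packedValue_eq_value {Q : Finset (Item ι)} {C : ℝ} {i : Item ι}
    (h : valueAbove Q i.value + i.value ≤ C) : packedValue Q C i = i.value :=
  min_eq_left (le_max_of_le_right (by linarith))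

theorem packedValue_le_packedValue {Q Q' : Finset (Item ι)} {C : ℝ} {i : Item ι}
    (h : valueAbove Q i.value ≤ valueAbove Q' i.value) :
    packedValue Q' C i ≤ packedValue Q C i :=
  min_le_min_left _ (max_le_max_left _ (by linarith))

/-- Items are inserted by decreasing value: a new least valuable item changes no earlier packed part
and receives what is left, up to its value. -/
theorem UnitItems.sum_packedValue {Q : Finset (Item ι)} (hQ : UnitItems Q) {C : ℝ} (hC : 0 ≤ C) :
    ∑ i ∈ Q, packedValue Q C i = min (totalValue Q) C := by
  induction Q using Finset.induction_on_min_value Item.value with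
  | empty => simp [totalValue, hC]
  | insert a s ha hmin ih =>
    have hs : UnitItems s := hQ.mono (Finset.subset_insert _ _)
    have hlt : ∀ x ∈ s, a.value < x.value := fun x hx =>
      lt_of_le_of_ne (hmin x hx) fun h => ha <| by
        rwa [hQ.inj a (Finset.mem_insert_self _ _) x (Finset.mem_insert_of_mem hx) h]
    have hapos := hQ.pos a (Finset.mem_insert_self _ _)
    have hsnn := hs.totalValue_nonneg
    have h1 : ∀ x ∈ s, packedValue (insert a s) C x = packedValue s C x := fun x hx => by
      rw [packedValue, packedValue, valueAbove, valueAbove, Finset.filter_insert,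
        if_neg (hlt x hx).not_gt]
    have h2 : valueAbove (insert a s) a.value = totalValue s := by
      rw [valueAbove, Finset.filter_insert, if_neg (lt_irrefl _), Finset.filter_true_of_mem hlt]
    have h3 : totalValue (insert a s) = a.value + totalValue s := Finset.sum_insert ha
    rw [Finset.sum_insert ha, Finset.sum_congr rfl h1, ih hs, h3, packedValue, h2]
    rcases le_total (totalValue s) C with h | h
    · rw [max_eq_right (by linarith), min_eq_left h, min_def, min_def]
      split_ifs <;> linarith
    · rw [max_eq_left (by linarith), min_eq_right h, min_eq_right hapos.le,
        min_eq_right (by linarith), zero_add]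

theorem UnitItems.quota_add_sum {Q : Finset (Item ι)} (hQ : UnitItems Q) {C : ℝ} (hC : 0 ≤ C)
    (a : ℕ) :
    quota a Q C + ∑ i ∈ Q.filter (fun i => i.owner ≠ a), packedValue Q C i =
      min (totalValue Q) C := by
  rw [← hQ.sum_packedValue hC, quota, ownedBy, Finset.sum_filter_add_sum_filter_not]

/-- The quota is min(v(Q), C) minus the share of the others. From `Q'` to `Q` the total does not
drop, while the others gain no items and have at least as much value ahead of them. -/
theorem UnitItems.quota_le_of_above_le {Q Q' : Finset (Item ι)} (hQ : UnitItems Q)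
    (hQ' : UnitItems Q') {C : ℝ} (hC : 0 ≤ C) {a : ℕ}
    (hothers : ∀ k ∈ Q, k.owner ≠ a → k ∈ Q')
    (habove : ∀ t, valueAbove Q' t ≤ valueAbove Q t) :
    quota a Q' C ≤ quota a Q C := by
  have h1 := hQ.quota_add_sum hC a
  have h2 := hQ'.quota_add_sum hC a
  have h3 : min (totalValue Q') C ≤ min (totalValue Q) C := by
    rw [← hQ.valueAbove_zero, ← hQ'.valueAbove_zero]
    exact min_le_min_right _ (habove 0)
  have h4 : ∑ i ∈ Q.filter (fun i => i.owner ≠ a), packedValue Q C i ≤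
      ∑ i ∈ Q'.filter (fun i => i.owner ≠ a), packedValue Q' C i := by
    refine (Finset.sum_le_sum fun i _ => packedValue_le_packedValue (habove i.value)).trans ?_
    refine Finset.sum_le_sum_of_subset_of_nonneg (fun k hk => ?_)
      fun i hi _ => hQ'.packedValue_nonneg C (Finset.mem_filter.1 hi).1
    rw [Finset.mem_filter] at hk ⊢
    exact ⟨hothers k hk.1 hk.2, hk.2⟩
  linarith

theorem UnitItems.quota_le_of_subset {Q Q' : Finset (Item ι)} (hQ : UnitItems Q)
    {C : ℝ} (hC : 0 ≤ C) {a : ℕ} (hsub : Q' ⊆ Q) (hothers : ∀ k ∈ Q, k.owner ≠ a → k ∈ Q') :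
    quota a Q' C ≤ quota a Q C :=
  hQ.quota_le_of_above_le (hQ.mono hsub) hC hothers (hQ.valueAbove_mono hsub)

/-- The opposite comparison, item by item: with less value ahead, each own item is packed at least
as far. -/
theorem UnitItems.quota_le_of_own {Q Q' : Finset (Item ι)} (hQ : UnitItems Q)
    {C : ℝ} {a : ℕ} (hown : ∀ k ∈ Q', k.owner = a → k ∈ Q)
    (habove : ∀ t, valueAbove Q t ≤ valueAbove Q' t) :
    quota a Q' C ≤ quota a Q C := by
  refine (Finset.sum_le_sum fun i _ => packedValue_le_packedValue (habove i.value)).trans ?_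
  refine Finset.sum_le_sum_of_subset_of_nonneg (fun k hk => ?_)
    fun i hi _ => hQ.packedValue_nonneg C (ownedBy_subset a Q hi)
  rw [mem_ownedBy] at hk ⊢
  exact ⟨hown k hk.1 hk.2, hk.2⟩

/-- Trading `p` for the more valuable item `r` increases the value above every threshold. -/
theorem UnitItems.valueAbove_le_of_swap {Q Q' : Finset (Item ι)} (hQ : UnitItems Q)
    {p r : Item ι} (hsub : Q'.erase p ⊆ Q.erase r) (hr : r ∈ Q)
    (hpr : p.value ≤ r.value) (t : ℝ) : valueAbove Q' t ≤ valueAbove Q t := by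
  have hrpos := hQ.pos r hr
  have key : valueAbove (Q'.erase p) t ≤ valueAbove (Q.erase r) t :=
    (hQ.mono (Finset.erase_subset _ _)).valueAbove_mono hsub t
  have hfr : valueAbove Q t = (if t < r.value then r.value else 0) + valueAbove (Q.erase r) t := by
    simp only [valueAbove, totalValue, Finset.sum_filter]
    exact (Finset.add_sum_erase Q (fun j => if t < j.value then j.value else 0) hr).symm
  by_cases hp : p ∈ Q'
  · have hfp : valueAbove Q' t =
        (if t < p.value then p.value else 0) + valueAbove (Q'.erase p) t := by
      simp only [valueAbove, totalValue, Finset.sum_filter]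
      exact (Finset.add_sum_erase Q' (fun j => if t < j.value then j.value else 0) hp).symm
    rw [hfr, hfp]
    split_ifs <;> linarith
  · rw [Finset.erase_eq_of_notMem hp] at key
    rw [hfr]
    split_ifs <;> linarith

theorem valueAbove_eq_zero {Q : Finset (Item ι)} {t : ℝ} (h : ∀ i ∈ Q, i.value ≤ t) :
    valueAbove Q t = 0 := by
  rw [valueAbove, Finset.filter_false_of_mem fun i hi => (h i hi).not_gt]
  rfl

/-- If the most valuable item belongs to another agent, then `a` only gets what it leaves over. -/
theorem UnitItems.quota_le_sub {Q : Finset (Item ι)} (hQ : UnitItems Q) {C : ℝ}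
    (hC : 0 ≤ C) {a : ℕ} {r : Item ι} (hr : r ∈ Q) (hra : r.owner ≠ a) (hrC : r.value ≤ C)
    (hmax : ∀ i ∈ Q, i.value ≤ r.value) : quota a Q C ≤ C - r.value := by
  have h1 := hQ.quota_add_sum hC a
  have h2 : packedValue Q C r ≤ ∑ i ∈ Q.filter (fun i => i.owner ≠ a), packedValue Q C i :=
    Finset.single_le_sum (f := packedValue Q C)
      (fun i hi => hQ.packedValue_nonneg C (Finset.mem_filter.1 hi).1)
      (Finset.mem_filter.2 ⟨hr, hra⟩)
  rw [packedValue_eq_value (by rw [valueAbove_eq_zero hmax]; linarith)] at h2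
  linarith [min_le_right (totalValue Q) C]

theorem UnitItems.le_quota {Q : Finset (Item ι)} (hQ : UnitItems Q) {C : ℝ} {a : ℕ}
    {r : Item ι} (hr : r ∈ Q) (hra : r.owner = a) (h : valueAbove Q r.value + r.value ≤ C) :
    r.value ≤ quota a Q C := by
  rw [← packedValue_eq_value h]
  exact Finset.single_le_sum (f := packedValue Q C)
    (fun i hi => hQ.packedValue_nonneg C (ownedBy_subset a Q hi)) (mem_ownedBy.2 ⟨hr, hra⟩)

theorem UnitItems.le_quota_of_max {Q : Finset (Item ι)} (hQ : UnitItems Q) {C : ℝ}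
    {r : Item ι} (hr : r ∈ Q) (hrC : r.value ≤ C) (hmax : ∀ i ∈ Q, i.value ≤ r.value) :
    r.value ≤ quota r.owner Q C :=
  hQ.le_quota hr rfl (by rw [valueAbove_eq_zero hmax]; linarith)

/-! ### Best bundles -/

/-- The best subset of the items of agent `a` whose value is at most `q`. -/
noncomputable def bestBundle (a : ℕ) (E : Finset (Item ι)) (q : ℝ) : Finset (Item ι) :=
  mostValuable ((ownedBy a E).powerset.filter (fun D => totalValue D ≤ q))

theorem mostValuable_mem {𝓓 : Finset (Finset (Item ι))} (h : 𝓓.Nonempty) :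
    mostValuable 𝓓 ∈ 𝓓 := by
  rw [mostValuable, dif_pos h]
  exact (Classical.choose_spec (𝓓.exists_max_image totalValue h)).1

theorem le_mostValuable {𝓓 : Finset (Finset (Item ι))} {D : Finset (Item ι)} (hD : D ∈ 𝓓) :
    totalValue D ≤ totalValue (mostValuable 𝓓) := by
  rw [mostValuable, dif_pos ⟨D, hD⟩]
  exact (Classical.choose_spec (𝓓.exists_max_image totalValue ⟨D, hD⟩)).2 D hD

theorem totalValue_empty : totalValue (∅ : Finset (Item ι)) = 0 := rfl

theorem totalSize_empty : totalSize (∅ : Finset (Item ι)) = 0 := rfl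

theorem bestBundle_spec (a : ℕ) (E : Finset (Item ι)) {q : ℝ} (hq : 0 ≤ q) :
    bestBundle a E q ⊆ ownedBy a E ∧ totalValue (bestBundle a E q) ≤ q := by
  have h : bestBundle a E q ∈ (ownedBy a E).powerset.filter (fun D => totalValue D ≤ q) :=
    mostValuable_mem ⟨∅, by simpa [totalValue_empty] using hq⟩
  simpa using h

theorem le_bestBundle {a : ℕ} {E D : Finset (Item ι)} {q : ℝ} (hD : D ⊆ ownedBy a E)
    (hq : totalValue D ≤ q) : totalValue D ≤ totalValue (bestBundle a E q) :=
  le_mostValuable (by simpa using ⟨hD, hq⟩)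

theorem value_le_bestBundle {a : ℕ} {E : Finset (Item ι)} {r : Item ι} {q : ℝ} (hr : r ∈ E)
    (hra : r.owner = a) (hq : r.value ≤ q) : r.value ≤ totalValue (bestBundle a E q) := by
  have h : totalValue {r} = r.value := Finset.sum_singleton _ _
  rw [← h] at hq ⊢
  exact le_bestBundle (Finset.singleton_subset_iff.2 (mem_ownedBy.2 ⟨hr, hra⟩)) hq

theorem bestBundle_mono {a : ℕ} {E E' : Finset (Item ι)} (hE : E' ⊆ E) {q q' : ℝ}
    (hq' : 0 ≤ q') (hq : q' ≤ q) :
    totalValue (bestBundle a E' q') ≤ totalValue (bestBundle a E q) :=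
  le_bestBundle ((bestBundle_spec a E' hq').1.trans (ownedBy_mono a hE))
    ((bestBundle_spec a E' hq').2.trans hq)

theorem UnitItems.restrictedGreedy_eq {Q : Finset (Item ι)} (hQ : UnitItems Q) (n : ℕ)
    (E : Finset (Item ι)) (C : ℝ) :
    restrictedGreedy n E Q C =
      (Finset.Icc 1 n).biUnion fun a => bestBundle a E (quota a Q C) := by
  simp only [restrictedGreedy, bestBundle, hQ.sum_eq_quota]

theorem UnitItems.ownedBy_restrictedGreedy {Q : Finset (Item ι)} (hQ : UnitItems Q) {n a : ℕ}
    (ha : a ∈ Finset.Icc 1 n) (E : Finset (Item ι)) (C : ℝ) :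
    ownedBy a (restrictedGreedy n E Q C) = bestBundle a E (quota a Q C) := by
  have hsub := fun b => (bestBundle_spec b E (hQ.quota_nonneg b C)).1
  rw [hQ.restrictedGreedy_eq]
  ext i
  rw [mem_ownedBy, Finset.mem_biUnion]
  constructor
  · rintro ⟨⟨b, -, hb⟩, rfl⟩
    rwa [(mem_ownedBy.1 (hsub b hb)).2]
  · exact fun hi => ⟨⟨a, ha, hi⟩, (mem_ownedBy.1 (hsub a hi)).2⟩

theorem UnitItems.restrictedGreedy_subset {Q : Finset (Item ι)} (hQ : UnitItems Q) (n : ℕ)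
    (E : Finset (Item ι)) (C : ℝ) : restrictedGreedy n E Q C ⊆ E := by
  rw [hQ.restrictedGreedy_eq, Finset.biUnion_subset]
  exact fun a _ => (bestBundle_spec a E (hQ.quota_nonneg a C)).1.trans (ownedBy_subset a E)

theorem sum_ownedBy {n : ℕ} {Q : Finset (Item ι)} (hn : ∀ i ∈ Q, i.owner ∈ Finset.Icc 1 n)
    (f : Item ι → ℝ) : ∑ a ∈ Finset.Icc 1 n, ∑ i ∈ ownedBy a Q, f i = ∑ i ∈ Q, f i :=
  Finset.sum_fiberwise_of_maps_to hn f

theorem UnitItems.totalValue_restrictedGreedy {E Q : Finset (Item ι)} (hE : UnitItems E)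
    (hQE : Q ⊆ E) {n : ℕ} (hn : ∀ i ∈ E, i.owner ∈ Finset.Icc 1 n) (C : ℝ) :
    totalValue (restrictedGreedy n E Q C) =
      ∑ a ∈ Finset.Icc 1 n, totalValue (bestBundle a E (quota a Q C)) := by
  have hQ := hE.mono hQE
  have h := sum_ownedBy (fun i hi => hn i (hQ.restrictedGreedy_subset n E C hi)) Item.value
  rw [totalValue, ← h]
  refine Finset.sum_congr rfl fun a ha => ?_
  rw [hQ.ownedBy_restrictedGreedy ha]
  rfl

theorem UnitItems.totalValue_restrictedGreedy_le {E Q : Finset (Item ι)} (hE : UnitItems E)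
    (hQE : Q ⊆ E) {n : ℕ} (hn : ∀ i ∈ E, i.owner ∈ Finset.Icc 1 n) {C : ℝ} (hC : 0 ≤ C) :
    totalValue (restrictedGreedy n E Q C) ≤ C := by
  have hQ := hE.mono hQE
  rw [hE.totalValue_restrictedGreedy hQE hn]
  calc _ ≤ ∑ a ∈ Finset.Icc 1 n, quota a Q C :=
        Finset.sum_le_sum fun a _ => (bestBundle_spec a E (hQ.quota_nonneg a C)).2
    _ = min (totalValue Q) C := by
        rw [← hQ.sum_packedValue hC]
        exact sum_ownedBy (fun i hi => hn i (hQE hi)) _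
    _ ≤ C := min_le_right _ _

/-- The items that the greedy solution packs fully are recovered by `RestrictedGreedy`. -/
theorem UnitItems.le_totalValue_restrictedGreedy {E Q F : Finset (Item ι)} (hE : UnitItems E)
    (hQE : Q ⊆ E) {n : ℕ} (hn : ∀ i ∈ E, i.owner ∈ Finset.Icc 1 n) {C : ℝ} (hFQ : F ⊆ Q)
    (hF : ∀ i ∈ F, valueAbove Q i.value + i.value ≤ C) :
    totalValue F ≤ totalValue (restrictedGreedy n E Q C) := by
  have hQ := hE.mono hQE
  rw [hE.totalValue_restrictedGreedy hQE hn, totalValue,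
    ← sum_ownedBy (fun i hi => hn i (hQE (hFQ hi))) Item.value]
  refine Finset.sum_le_sum fun a _ => le_bestBundle (ownedBy_mono a (hFQ.trans hQE)) ?_
  calc totalValue (ownedBy a F) = ∑ i ∈ ownedBy a F, packedValue Q C i :=
        Finset.sum_congr rfl fun i hi => (packedValue_eq_value (hF i (ownedBy_subset a F hi))).symm
    _ ≤ quota a Q C := Finset.sum_le_sum_of_subset_of_nonneg (ownedBy_mono a hFQ)
        fun i hi _ => hQ.packedValue_nonneg C (ownedBy_subset a Q hi)

/-! ### Instances without a large individual bundle -/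

/-- Unit-density items each of which fits, such that no single agent owns a feasible bundle of
value at least `2/3` of the capacity. -/
structure NoLargeBundle (E : Finset (Item ι)) (C : ℝ) : Prop extends UnitItems E where
  capacity_pos : 0 < C
  le_capacity : ∀ i ∈ E, i.value ≤ C
  bundle_lt : ∀ a, ∀ D ⊆ ownedBy a E, totalValue D ≤ C → totalValue D < 2 / 3 * C

section

variable {E E' : Finset (Item ι)} {C : ℝ} {a : ℕ}

theorem NoLargeBundle.mono (hE : NoLargeBundle E C) (h : E' ⊆ E) : NoLargeBundle E' C :=
  ⟨hE.toUnitItems.mono h, hE.capacity_pos, fun i hi => hE.le_capacity i (h hi),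
    fun a _ hD => hE.bundle_lt a _ (hD.trans (ownedBy_mono a h))⟩

theorem NoLargeBundle.value_lt (hE : NoLargeBundle E C) {i : Item ι} (hi : i ∈ E) :
    i.value < 2 / 3 * C := by
  have h : totalValue {i} = i.value := Finset.sum_singleton _ _
  rw [← h]
  exact hE.bundle_lt i.owner _ (Finset.singleton_subset_iff.2 (mem_ownedBy.2 ⟨hi, rfl⟩))
    (h.le.trans (hE.le_capacity i hi))

/-- The main use of the threshold: the smaller of the two items is below C/3. -/
theorem NoLargeBundle.pair_lt (hE : NoLargeBundle E C) {i j : Item ι} (hi : i ∈ E) (hj : j ∈ E)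
    (hij : i ≠ j) (ho : i.owner = j.owner) (hC : i.value + j.value ≤ C) :
    i.value + j.value < 2 / 3 * C := by
  have h : totalValue {i, j} = i.value + j.value := Finset.sum_pair hij
  rw [← h] at hC ⊢
  refine hE.bundle_lt j.owner _ (fun k hk => ?_) hC
  rcases Finset.mem_insert.1 hk with rfl | hk
  · exact mem_ownedBy.2 ⟨hi, ho⟩
  · rw [Finset.mem_singleton.1 hk]
    exact mem_ownedBy.2 ⟨hj, rfl⟩

/-- `i` fits together with every less valuable item of any other agent. -/
def Fits (E : Finset (Item ι)) (C : ℝ) (i : Item ι) : Prop :=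
  ∀ j ∈ E, j.owner ≠ i.owner → j.value < i.value → i.value + j.value ≤ C

/-- `p` is the most valuable item of `E` that fits together with every less valuable item of any
other agent. -/
structure IsTopFit (E : Finset (Item ι)) (C : ℝ) (p : Item ι) : Prop where
  mem : p ∈ E
  fits : Fits E C p
  le : ∀ i ∈ E, Fits E C i → i.value ≤ p.value

/-- The item `p` and all items of `E` that fit together with it. -/
noncomputable def compatible (E : Finset (Item ι)) (C : ℝ) (p : Item ι) : Finset (Item ι) :=
  {p} ∪ E.filter (fun i => p.value + i.value ≤ C)

theorem mem_compatible {p i : Item ι} :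
    i ∈ compatible E C p ↔ i = p ∨ (i ∈ E ∧ p.value + i.value ≤ C) := by
  simp [compatible]

variable {p p' : Item ι}

theorem compatible_subset (hp : p ∈ E) : compatible E C p ⊆ E := by
  intro i hi
  rcases mem_compatible.1 hi with rfl | hi
  exacts [hp, hi.1]

/-- Items that are more valuable than the top fitting item do not fit together with it. -/
theorem IsTopFit.lt_add (hp : IsTopFit E C p) {k : Item ι} (hk : k ∈ E)
    (hpk : p.value < k.value) : C < p.value + k.value := by
  by_contra! hcon
  -- The least valuable item `m` above `p` would fit: items below `m` are worth at most `p`, and `m`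
  -- is worth at most `k`. This contradicts the choice of `p`.
  obtain ⟨m, hm, hmin⟩ := (E.filter (fun i => p.value < i.value)).exists_min_image Item.value
    ⟨k, Finset.mem_filter.2 ⟨hk, hpk⟩⟩
  rw [Finset.mem_filter] at hm
  have hmk := hmin k (Finset.mem_filter.2 ⟨hk, hpk⟩)
  refine hm.2.not_ge (hp.le m hm.1 fun j hj _ hjm => ?_)
  by_contra! hlt
  have := hmin j (Finset.mem_filter.2 ⟨hj, by linarith⟩)
  linarith

theorem IsTopFit.le_of_mem (hp : IsTopFit E C p) {k : Item ι} (hk : k ∈ compatible E C p) :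
    k.value ≤ p.value := by
  rcases mem_compatible.1 hk with rfl | hk
  · exact le_rfl
  · by_contra! h
    linarith [hp.lt_add hk.1 h]

/-- Hiding items of agent `a` does not increase what `a` obtains in the second case of `FitTwo`. -/
theorem NoLargeBundle.bestBundle_compatible_le (hE : NoLargeBundle E C) (hsub : E' ⊆ E)
    (hhide : E \ E' ⊆ ownedBy a E) (hp : IsTopFit E C p) (hp' : IsTopFit E' C p') :
    totalValue (bestBundle a E' (quota a (compatible E' C p') C)) ≤
      totalValue (bestBundle a E (quota a (compatible E C p) C)) := by
  have hE' := hE.mono hsub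
  have hC := hE.capacity_pos.le
  have hRE := compatible_subset (C := C) hp.mem
  have hRE' := compatible_subset (C := C) hp'.mem
  have hR := hE.toUnitItems.mono hRE
  have hR' := hE'.toUnitItems.mono hRE'
  have hpR : p ∈ compatible E C p := mem_compatible.2 (Or.inl rfl)
  have hpR' : p' ∈ compatible E' C p' := mem_compatible.2 (Or.inl rfl)
  have hq' := hR'.quota_nonneg a C
  have hkeep : ∀ i ∈ E, i.owner ≠ a → i ∈ E' := fun i hi hia => by
    by_contra h
    exact hia (mem_ownedBy.1 (hhide (Finset.mem_sdiff.2 ⟨hi, h⟩))).2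
  -- In the second alternative the single item `t` is affordable under the old quota and already
  -- worth the whole new quota.
  suffices hmain : quota a (compatible E' C p') C ≤ quota a (compatible E C p) C ∨
      ∃ t ∈ E, t.owner = a ∧ t.value ≤ quota a (compatible E C p) C ∧
        quota a (compatible E' C p') C ≤ t.value by
    rcases hmain with h | ⟨t, ht, hta, h1, h2⟩
    · exact bestBundle_mono hsub hq' h
    · exact ((bestBundle_spec a E' hq').2.trans h2).trans (value_le_bestBundle ht hta h1)
  by_cases hpE' : p ∈ E'
  · have hle : p.value ≤ p'.value := hp'.le p hpE' fun j hj => hp.fits j (hsub hj)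
    rcases hle.eq_or_lt with heq | hlt
    · obtain rfl := hE.inj p hp.mem p' (hsub hp'.mem) heq
      refine Or.inl (hR.quota_le_of_subset hC (fun k hk => ?_) fun k hk hka => ?_)
      · exact mem_compatible.2 ((mem_compatible.1 hk).imp_right fun h => ⟨hsub h.1, h.2⟩)
      · exact mem_compatible.2 ((mem_compatible.1 hk).imp_right fun h => ⟨hkeep k h.1 hka, h.2⟩)
    · -- the new top item belongs to an agent other than `a`
      have hnot : ¬ Fits E C p' := fun h => (hp.le p' (hsub hp'.mem) h).not_gt hlt
      simp only [Fits, not_forall, not_le] at hnot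
      obtain ⟨j, hj, hjo, hjp, hjC⟩ := hnot
      have hja : j.owner = a := by
        by_contra h
        exact hjC.not_ge (hp'.fits j (hkeep j hj h) hjo hjp)
      have hpa' : p'.owner ≠ a := fun h => hjo (hja.trans h.symm)
      have hp'lt := hE'.value_lt hp'.mem
      have hqle : quota a (compatible E' C p') C ≤ C - p'.value :=
        hR'.quota_le_sub hC hpR' hpa' (hE'.le_capacity p' hp'.mem) fun i hi => hp'.le_of_mem hi
      -- items of other agents that are large but below `p'` have the same owner as `p'`
      have hown : ∀ k ∈ E, k.owner ≠ a → k.value < p'.value → C - p'.value < k.value →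
          k.owner = p'.owner := fun k hk hka hkp hkC => by
        by_contra h
        linarith [hp'.fits k (hkeep k hk hka) h hkp]
      -- in particular no other agent's item in the compatible set of `p` is large
      have hother : ∀ k ∈ compatible E C p, k ≠ p → k.owner ≠ a → p.owner ≠ a →
          k.value ≤ C - p'.value := fun k hk hkp hka hpa => by
        by_contra! hkC
        have hkle := hp.le_of_mem hk
        have hkE := hRE hk
        have hfit := ((mem_compatible.1 hk).resolve_left hkp).2
        have h1 := hown k hkE hka (by linarith) hkC
        have h2 := hown p hp.mem hpa hlt (by linarith)
        -- `p` and `k` share an owner and fit together, yet both exceed C - v(p') > C/3.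
        have := hE.pair_lt hp.mem hkE (Ne.symm hkp) (h2.trans h1.symm) hfit
        linarith
      -- The new quota is at most C - v(p'), so an own item above this bound separates the quotas
      -- once it is affordable. The largest such item has at most `p` ahead of it, unless `p` itself
      -- is own and pays for it.
      by_cases hlarge : ∃ t ∈ compatible E C p, t.owner = a ∧ C - p'.value < t.value
      · right
        obtain ⟨t, ht, htmax⟩ := ((compatible E C p).filter
          (fun t => t.owner = a ∧ C - p'.value < t.value)).exists_max_image Item.value (by
            obtain ⟨t, h⟩ := hlarge
            exact ⟨t, Finset.mem_filter.2 h⟩)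
        obtain ⟨htR, hta, htC⟩ := Finset.mem_filter.1 ht
        refine ⟨t, hRE htR, hta, ?_, by linarith⟩
        by_cases hpa : p.owner = a
        · have h := hR.le_quota_of_max hpR (hE.le_capacity p hp.mem) fun i hi => hp.le_of_mem hi
          rw [hpa] at h
          exact (hp.le_of_mem htR).trans h
        · have htp : t ≠ p := fun h => hpa (h ▸ hta)
          have hfit := ((mem_compatible.1 htR).resolve_left htp).2
          refine hR.le_quota htR hta ?_
          have hsubp : (compatible E C p).filter (fun k => t.value < k.value) ⊆ {p} := by
            intro k hk
            obtain ⟨hkR, hkt⟩ := Finset.mem_filter.1 hk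
            rw [Finset.mem_singleton]
            by_contra hkp
            by_cases hka : k.owner = a
            · exact hkt.not_ge (htmax k (Finset.mem_filter.2 ⟨hkR, hka, htC.trans hkt⟩))
            · linarith [hother k hkR hkp hka hpa]
          have h1 : valueAbove (compatible E C p) t.value ≤ totalValue {p} :=
            (hE.toUnitItems.mono (Finset.singleton_subset_iff.2 hp.mem)).totalValue_mono hsubp
          have h2 : totalValue {p} = p.value := Finset.sum_singleton _ _
          linarith
      · push Not at hlarge
        left
        have hsmall : ∀ k ∈ compatible E C p, k ≠ p → k.value ≤ C - p'.value := by
          intro k hk hkp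
          by_cases hka : k.owner = a
          · exact hlarge k hk hka
          by_cases hpa : p.owner = a
          · exact (hp.le_of_mem hk).trans (hlarge p hpR hpa)
          · exact hother k hk hkp hka hpa
        -- All items of `T` except `p` fit with `p'`. Passing to the new set thus trades `p` for the
        -- larger `p'`, and puts more value ahead of the items of `a`.
        set T := (compatible E C p).filter (fun i => i ∈ E')
        have hTR : T ⊆ compatible E C p := Finset.filter_subset _ _
        have h1 : quota a T C ≤ quota a (compatible E C p) C :=
          hR.quota_le_of_subset hC hTR fun k hk hka =>
            Finset.mem_filter.2 ⟨hk, hkeep k (hRE hk) hka⟩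
        refine le_trans ?_ h1
        refine (hR.mono hTR).quota_le_of_own (fun k hk hka => ?_)
          (hR'.valueAbove_le_of_swap (p := p) (r := p') (fun k hk => ?_) hpR' hlt.le)
        · obtain ⟨hkE, hkC⟩ := (mem_compatible.1 hk).resolve_left fun h => hpa' (h ▸ hka)
          exact Finset.mem_filter.2 ⟨mem_compatible.2 (Or.inr ⟨hsub hkE, by linarith⟩), hkE⟩
        · obtain ⟨hkp, hkT⟩ := Finset.mem_erase.1 hk
          obtain ⟨hkR, hkE⟩ := Finset.mem_filter.1 hkT
          have hks := hsmall k hkR hkp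
          refine Finset.mem_erase.2 ⟨?_, mem_compatible.2 (Or.inr ⟨hkE, by linarith⟩)⟩
          rintro rfl
          linarith [hp.le_of_mem hkR]
  -- Now `p` itself is hidden.
  · have hpa : p.owner = a := by
      by_contra h
      exact hpE' (hkeep p hp.mem h)
    have hpq : p.value ≤ quota a (compatible E C p) C := hpa ▸
      hR.le_quota_of_max hpR (hE.le_capacity p hp.mem) fun i hi => hp.le_of_mem hi
    have hne : p' ≠ p := fun h => hpE' (h ▸ hp'.mem)
    rcases lt_trichotomy p'.value p.value with hlt | heq | hgt
    · left
      have hothers : ∀ k ∈ compatible E C p, k.owner ≠ a → k ∈ compatible E' C p' :=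
        fun k hk hka => by
          obtain ⟨hkE, hkC⟩ := (mem_compatible.1 hk).resolve_left fun h => hka (h ▸ hpa)
          exact mem_compatible.2 (Or.inr ⟨hkeep k hkE hka, by linarith⟩)
      by_cases hpa' : p'.owner = a
      · refine hR.quota_le_of_above_le hR' hC hothers
          (hR.valueAbove_le_of_swap (p := p') (r := p) (fun k hk => ?_) hpR hlt.le)
        obtain ⟨hkp', hkR'⟩ := Finset.mem_erase.1 hk
        obtain ⟨hkE', hkC⟩ := (mem_compatible.1 hkR').resolve_left hkp'
        have hkle := hp'.le_of_mem hkR'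
        refine Finset.mem_erase.2 ⟨fun h => hpE' (h ▸ hkE'),
          mem_compatible.2 (Or.inr ⟨hsub hkE', ?_⟩)⟩
        by_cases hka : k.owner = a
        -- `k` is the smaller of two own items that fit together, so it is below C/3 and fits with
        -- `p`, which is below 2C/3.
        · by_contra! hgt
          have h1 := hE'.pair_lt hp'.mem hkE' (Ne.symm hkp') (hpa'.trans hka.symm) hkC
          have h2 := hE.value_lt hp.mem
          linarith
        · exact hp.fits k (hsub hkE') (fun h => hka (h.trans hpa)) (by linarith)
      · refine hR.quota_le_of_subset hC (fun k hk => ?_) hothers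
        have hfit := hp.fits p' (hsub hp'.mem) (fun h => hpa' (h.trans hpa)) hlt
        exact mem_compatible.2 (Or.inr ⟨hsub (hRE' hk), by linarith [hp'.le_of_mem hk]⟩)
    · exact absurd (hE.inj p' (hsub hp'.mem) p hp.mem heq) hne
    -- An own `p'` would fit in `E` as well, because the items of the other agents are all kept.
    · have hpa' : p'.owner ≠ a := fun hpa' => by
        refine hgt.not_ge (hp.le p' (hsub hp'.mem) fun j hj hjo hjp => ?_)
        exact hp'.fits j (hkeep j hj fun h => hjo (h.trans hpa'.symm)) hjo hjp
      have hqle : quota a (compatible E' C p') C ≤ C - p'.value :=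
        hR'.quota_le_sub hC hpR' hpa' (hE'.le_capacity p' hp'.mem) fun i hi => hp'.le_of_mem hi
      have := hp.lt_add (hsub hp'.mem) hgt
      exact Or.inr ⟨p, hp.mem, hpa, hpq, by linarith⟩

/-! ### The restricted set of `LargeFit` -/

/-- `j` is the most valuable item of `E`. -/
structure IsTop (E : Finset (Item ι)) (j : Item ι) : Prop where
  mem : j ∈ E
  le : ∀ i ∈ E, i.value ≤ j.value

/-- All items of the owner of `j` and all items of other agents that fit together with `j`. -/
noncomputable def ownOrCompatible (E : Finset (Item ι)) (C : ℝ) (j : Item ι) : Finset (Item ι) :=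
  ownedBy j.owner E ∪ (E \ ownedBy j.owner E).filter (fun i => j.value + i.value ≤ C)

variable {j j' : Item ι}

theorem mem_ownOrCompatible {i : Item ι} :
    i ∈ ownOrCompatible E C j ↔ i ∈ E ∧ (i.owner = j.owner ∨ j.value + i.value ≤ C) := by
  simp only [ownOrCompatible, Finset.mem_union, Finset.mem_filter, Finset.mem_sdiff, mem_ownedBy]
  tauto

theorem ownOrCompatible_subset : ownOrCompatible E C j ⊆ E :=
  fun _ hi => (mem_ownOrCompatible.1 hi).1

/-- Hiding items of agent `a` does not increase what `a` obtains in the second case of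
`LargeFit`. -/
theorem NoLargeBundle.bestBundle_ownOrCompatible_le (hE : NoLargeBundle E C) (hsub : E' ⊆ E)
    (hhide : E \ E' ⊆ ownedBy a E) (hj : IsTop E j) (hj' : IsTop E' j') :
    totalValue (bestBundle a E' (quota a (ownOrCompatible E' C j') C)) ≤
      totalValue (bestBundle a E (quota a (ownOrCompatible E C j) C)) := by
  have hE' := hE.mono hsub
  have hC := hE.capacity_pos.le
  have hS := hE.toUnitItems.mono (ownOrCompatible_subset (C := C) (j := j))
  have hS' := hE'.toUnitItems.mono (ownOrCompatible_subset (C := C) (j := j'))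
  have hq' := hS'.quota_nonneg a C
  have hjS : j ∈ ownOrCompatible E C j := mem_ownOrCompatible.2 ⟨hj.mem, Or.inl rfl⟩
  have hjS' : j' ∈ ownOrCompatible E' C j' := mem_ownOrCompatible.2 ⟨hj'.mem, Or.inl rfl⟩
  have hkeep : ∀ i ∈ E, i.owner ≠ a → i ∈ E' := fun i hi hia => by
    by_contra h
    exact hia (mem_ownedBy.1 (hhide (Finset.mem_sdiff.2 ⟨hi, h⟩))).2
  by_cases hjE' : j ∈ E'
  · obtain rfl := hE.inj j hj.mem j' (hsub hj'.mem)
      (le_antisymm (hj'.le j hjE') (hj.le j' (hsub hj'.mem)))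
    refine bestBundle_mono hsub hq' (hS.quota_le_of_subset hC (fun k hk => ?_) fun k hk hka => ?_)
    · exact mem_ownOrCompatible.2 ((mem_ownOrCompatible.1 hk).imp_left fun h => hsub h)
    · exact mem_ownOrCompatible.2 ((mem_ownOrCompatible.1 hk).imp_left fun h => hkeep k h hka)
  · have hja : j.owner = a := by
      by_contra h
      exact hjE' (hkeep j hj.mem h)
    have hlej := hj.le j' (hsub hj'.mem)
    by_cases hja' : j'.owner = a
    · refine bestBundle_mono hsub hq' ?_
      -- Own items are never excluded from either set, and the smaller `j'` admits every kept item
      -- of others that `j` admits.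
      set T := (ownOrCompatible E C j).filter (fun i => i ∈ E')
      have hTS : T ⊆ ownOrCompatible E C j := Finset.filter_subset _ _
      have h1 : quota a T C ≤ quota a (ownOrCompatible E C j) C :=
        hS.quota_le_of_subset hC hTS fun k hk hka =>
          Finset.mem_filter.2 ⟨hk, hkeep k (ownOrCompatible_subset hk) hka⟩
      refine le_trans ((hS.mono hTS).quota_le_of_own (fun k hk hka => ?_)
        (hS'.valueAbove_mono fun k hk => ?_)) h1
      · have hkE := ownOrCompatible_subset hk
        exact Finset.mem_filter.2
          ⟨mem_ownOrCompatible.2 ⟨hsub hkE, Or.inl (hka.trans hja.symm)⟩, hkE⟩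
      · obtain ⟨hkS, hkE⟩ := Finset.mem_filter.1 hk
        refine mem_ownOrCompatible.2 ⟨hkE, ?_⟩
        rcases (mem_ownOrCompatible.1 hkS).2 with h | h
        · exact Or.inl (h.trans (hja.trans hja'.symm))
        · exact Or.inr (by linarith)
    · have hqle : quota a (ownOrCompatible E' C j') C ≤ C - j'.value :=
        hS'.quota_le_sub hC hjS' hja' (hE'.le_capacity j' hj'.mem)
          fun i hi => hj'.le i (ownOrCompatible_subset hi)
      -- If `j'` fits with `j`, so does all of `E'`, and the new set is all of `E'`. If not, `j`
      -- separates the quotas.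
      by_cases hfit : j.value + j'.value ≤ C
      · refine bestBundle_mono hsub hq'
          (hS.quota_le_of_subset hC (fun k hk => ?_) fun k hk hka => ?_)
        · have hkE := ownOrCompatible_subset hk
          exact mem_ownOrCompatible.2 ⟨hsub hkE, Or.inr (by linarith [hj'.le k hkE])⟩
        · have hkE := hkeep k (ownOrCompatible_subset hk) hka
          exact mem_ownOrCompatible.2 ⟨hkE, Or.inr (by linarith [hj'.le k hkE])⟩
      · have hjq : j.value ≤ quota a (ownOrCompatible E C j) C := hja ▸
          hS.le_quota_of_max hjS (hE.le_capacity j hj.mem)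
            fun i hi => hj.le i (ownOrCompatible_subset hi)
        calc _ ≤ quota a (ownOrCompatible E' C j') C := (bestBundle_spec a E' hq').2
          _ ≤ j.value := by linarith
          _ ≤ _ := value_le_bestBundle hj.mem hja hjq

/-! ### The approximation guarantee -/

theorem NoLargeBundle.le_totalValue_largeFit (hE : NoLargeBundle E C) {n : ℕ}
    (hn : ∀ i ∈ E, i.owner ∈ Finset.Icc 1 n) (hj : IsTop E j) :
    j.value ≤ totalValue (restrictedGreedy n E (ownOrCompatible E C j) C) := by
  have h : totalValue {j} = j.value := Finset.sum_singleton _ _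
  rw [← h]
  refine hE.toUnitItems.le_totalValue_restrictedGreedy ownOrCompatible_subset hn
    (Finset.singleton_subset_iff.2 (mem_ownOrCompatible.2 ⟨hj.mem, Or.inl rfl⟩)) fun i hi => ?_
  obtain rfl := Finset.mem_singleton.1 hi
  rw [valueAbove_eq_zero fun k hk => hj.le k (ownOrCompatible_subset hk), zero_add]
  exact hE.le_capacity i hj.mem

/-- At most one item of a feasible set does not fit together with the top fitting item. -/
theorem NoLargeBundle.eq_of_notMem_compatible (hE : NoLargeBundle E C) (hp : IsTopFit E C p)
    {k l : Item ι} (hk : k ∈ E) (hl : l ∈ E) (hkR : k ∉ compatible E C p)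
    (hlR : l ∉ compatible E C p) (hkl : k.value + l.value ≤ C) : k = l := by
  wlog hle : k.value ≤ l.value generalizing k l
  · exact (this hl hk hlR hkR (by linarith) (by linarith)).symm
  by_contra hne
  simp only [mem_compatible, not_or, not_and, not_le] at hkR hlR
  have hkC := hkR.2 hk
  have hlC := hlR.2 hl
  have hlt : k.value < l.value := lt_of_le_of_ne hle fun h => hne (hE.inj k hk l hl h)
  have hlp : l.value < p.value := by linarith
  have hown : ∀ m ∈ E, m.value < p.value → C < p.value + m.value → m.owner = p.owner :=
    fun m hm hmp hmC => by
      by_contra h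
      linarith [hp.fits m hm h hmp]
  -- Both items lie below `p` without fitting with it, so they belong to its owner, and each exceeds
  -- C - v(p) > C/3.
  have := hE.pair_lt hk hl hne
    ((hown k hk (by linarith) hkC).trans (hown l hl hlp hlC).symm) hkl
  linarith [hE.value_lt hp.mem]

/-- In the second case, the two mechanisms together obtain a `2/3`-fraction of any feasible
set. -/
theorem NoLargeBundle.two_mul_totalValue_le (hE : NoLargeBundle E C) {n : ℕ}
    (hn : ∀ i ∈ E, i.owner ∈ Finset.Icc 1 n) (hp : IsTopFit E C p) (hj : IsTop E j)
    {O : Finset (Item ι)} (hOE : O ⊆ E) (hOC : totalValue O ≤ C) :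
    2 * totalValue O ≤ 2 * totalValue (restrictedGreedy n E (compatible E C p) C) +
      totalValue (restrictedGreedy n E (ownOrCompatible E C j) C) := by
  have hLF := hE.le_totalValue_largeFit hn hj
  have hRE := compatible_subset (C := C) hp.mem
  have hR := hE.toUnitItems.mono hRE
  have hpR : p ∈ compatible E C p := mem_compatible.2 (Or.inl rfl)
  have hO := hE.toUnitItems.mono hOE
  have hjpos := hE.pos j hj.mem
  have hpj := hj.le p hp.mem
  have hpair : ∀ k ∈ O, ∀ l ∈ O, k ≠ l → k.value + l.value ≤ C := fun k hk l hl hkl => by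
    have h : totalValue {k, l} = k.value + l.value := Finset.sum_pair hkl
    rw [← h]
    refine (hO.totalValue_mono fun i hi => ?_).trans hOC
    rcases Finset.mem_insert.1 hi with rfl | hi
    exacts [hk, Finset.mem_singleton.1 hi ▸ hl]
  by_cases hcov : ∀ i ∈ compatible E C p, valueAbove (compatible E C p) i.value + i.value ≤ C
  · have hFT := hE.toUnitItems.le_totalValue_restrictedGreedy hRE hn subset_rfl hcov
    by_cases hOR : O ⊆ compatible E C p
    · linarith [hR.totalValue_mono hOR]
    · obtain ⟨k, hkO, hkR⟩ := Finset.not_subset.1 hOR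
      have hkE := hOE hkO
      have hkC : C < p.value + k.value := by
        simp only [mem_compatible, not_or, not_and, not_le] at hkR
        exact hkR.2 hkE
      have hkp : k ≠ p := fun h => hkR (h ▸ hpR)
      have hpO : p ∉ O := fun h => by linarith [hpair k hkO p h hkp]
      have hsubset : O.erase k ⊆ (compatible E C p).erase p := fun l hl => by
        obtain ⟨hlk, hlO⟩ := Finset.mem_erase.1 hl
        refine Finset.mem_erase.2 ⟨fun h => hpO (h ▸ hlO), ?_⟩
        by_contra hlR
        exact hlk (hE.eq_of_notMem_compatible hp (hOE hlO) hkE hlR hkR (hpair l hlO k hkO hlk))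
      have h1 := (hR.mono (Finset.erase_subset p _)).totalValue_mono hsubset
      have h2 : k.value + totalValue (O.erase k) = totalValue O :=
        Finset.add_sum_erase _ _ hkO
      have h3 : p.value + totalValue ((compatible E C p).erase p) =
          totalValue (compatible E C p) := Finset.add_sum_erase _ _ hpR
      -- Here v(O) ≤ v(R) - v(p) + v(k). From v(k) < 2C/3 and v(p) > C - v(k) > C/3 follows v(k) <
      -- 2v(p), so 2(v(k) - v(p)) ≤ v(k) ≤ v(j).
      have h4 := hj.le k hkE
      have h5 := hE.value_lt hkE
      linarith
  · push Not at hcov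
    obtain ⟨f, hf, hfmax⟩ := ((compatible E C p).filter
      (fun i => C < valueAbove (compatible E C p) i.value + i.value)).exists_max_image Item.value
        (by
          obtain ⟨i, h⟩ := hcov
          exact ⟨i, Finset.mem_filter.2 h⟩)
    obtain ⟨hfR, hfC⟩ := Finset.mem_filter.1 hf
    set F := (compatible E C p).filter (fun i => f.value < i.value)
    have hFR : F ⊆ compatible E C p := Finset.filter_subset _ _
    have hFfull : ∀ i ∈ F, valueAbove (compatible E C p) i.value + i.value ≤ C := fun i hi => by
      obtain ⟨hiR, hif⟩ := Finset.mem_filter.1 hi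
      by_contra! h
      exact hif.not_ge (hfmax i (Finset.mem_filter.2 ⟨hiR, h⟩))
    have hsumF : C < totalValue F + f.value := hfC
    have hFT := hE.toUnitItems.le_totalValue_restrictedGreedy hRE hn hFR hFfull
    have hfp : f ≠ p := by
      rintro rfl
      rw [valueAbove_eq_zero fun k hk => hp.le_of_mem hk] at hfC
      linarith [hE.le_capacity f hp.mem]
    have hffit := ((mem_compatible.1 hfR).resolve_left hfp).2
    have hpF : p ∈ F := Finset.mem_filter.2 ⟨hpR, lt_of_le_of_ne (hp.le_of_mem hfR)
      fun h => hfp (hE.inj f (hRE hfR) p hp.mem h)⟩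
    have hsplit : p.value + totalValue (F.erase p) = totalValue F :=
      Finset.add_sum_erase _ _ hpF
    -- `p` and `f` fit together but v(F) + v(f) > C, so `p` is not alone in `F`.
    obtain ⟨k, hk⟩ : (F.erase p).Nonempty := by
      rw [Finset.nonempty_iff_ne_empty]
      intro h
      rw [h, totalValue_empty] at hsplit
      linarith
    have hkF := Finset.mem_of_mem_erase hk
    have hpf := (Finset.mem_filter.1 hpF).2
    have hkf := (Finset.mem_filter.1 hkF).2
    have hsplit2 : k.value + totalValue ((F.erase p).erase k) = totalValue (F.erase p) :=
      Finset.add_sum_erase _ _ hk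
    have hrest := (hR.mono ((Finset.erase_subset k _).trans
      ((Finset.erase_subset p _).trans hFR))).totalValue_nonneg
    rcases le_or_gt (2 * j.value) C with hjC | hjC
    -- All pairs fit, so both restricted sets are `E`. Two items of `F` exceed `f`, hence v(F) >
    -- 2C/3, and both outputs are worth at least v(F).
    · have hpjeq : p = j := hE.inj p hp.mem j hj.mem (le_antisymm hpj
        (hp.le j hj.mem fun i _ _ hij => by linarith))
      subst hpjeq
      have hRS : compatible E C p = ownOrCompatible E C p := by
        ext i
        rw [mem_compatible, mem_ownOrCompatible]
        constructor
        · rintro (rfl | h)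
          exacts [⟨hp.mem, Or.inl rfl⟩, ⟨h.1, Or.inr h.2⟩]
        · exact fun h => Or.inr ⟨h.1, by linarith [hj.le i h.1]⟩
      rw [← hRS]
      linarith
    -- With v(F) - v(p) ≥ v(k) > v(f), this gives 2v(F) + v(j) > (v(F) + v(f)) + (v(p) + v(j)) > 2C.
    · have hpjC : C ≤ p.value + j.value := by
        rcases hpj.eq_or_lt with h | h
        · linarith
        · exact (hp.lt_add hj.mem h).le
      by_cases hG : (F.erase p).erase k = ∅
      · rw [hG, totalValue_empty] at hsplit2
        linarith
      · obtain ⟨l, hl⟩ := Finset.nonempty_iff_ne_empty.2 hG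
        have hlf := (Finset.mem_filter.1 (Finset.mem_of_mem_erase (Finset.mem_of_mem_erase hl))).2
        have h3 : l.value ≤ totalValue ((F.erase p).erase k) :=
          Finset.single_le_sum (f := Item.value) (fun i hi => (hR.pos i (hFR
            (Finset.mem_of_mem_erase (Finset.mem_of_mem_erase hi)))).le) hl
        linarith

end

/-! ### The mechanisms -/

theorem opt_spec (E : Finset (Item ι)) {C : ℝ} (hC : 0 ≤ C) :
    opt E C ⊆ E ∧ totalSize (opt E C) ≤ C := by
  have h : opt E C ∈ E.powerset.filter (fun D => totalSize D ≤ C) :=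
    mostValuable_mem ⟨∅, by simpa [totalSize_empty] using hC⟩
  simpa using h

theorem le_opt {E D : Finset (Item ι)} {C : ℝ} (hD : D ⊆ E) (hs : totalSize D ≤ C) :
    totalValue D ≤ totalValue (opt E C) :=
  le_mostValuable (by simpa using ⟨hD, hs⟩)

section

variable {I : KnapsackInstance ι}

theorem unitItems_of_mem (hI : I ∈ unitDensity ι) : UnitItems I.items where
  pos := I.value_pos
  size_eq i hi := ((div_eq_one_iff_eq (I.size_pos i hi).ne').1 (hI i hi)).symm
  inj i hi j hj h := by
    by_contra hne
    exact I.value_ne i hi j hj hne h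

theorem restrict_mem_unitDensity (hI : I ∈ unitDensity ι) {E' : Finset (Item ι)}
    (h : E' ⊆ I.items) : I.restrict E' h ∈ unitDensity ι :=
  fun i hi => hI i (h hi)

theorem bestAgent_spec (I : KnapsackInstance ι) :
    bestAgent I ∈ Finset.Icc 1 I.n ∧ ∀ a ∈ Finset.Icc 1 I.n,
      totalValue (opt (ownedBy a I.items) I.capacity) ≤ totalValue (bestIndividual I) :=
  Classical.choose_spec ((Finset.Icc 1 I.n).exists_max_image
    (fun a => totalValue (opt (ownedBy a I.items) I.capacity))
    (Finset.nonempty_Icc.mpr I.n_pos))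

theorem bestIndividual_spec (I : KnapsackInstance ι) :
    bestIndividual I ⊆ ownedBy (bestAgent I) I.items ∧
      totalSize (bestIndividual I) ≤ I.capacity :=
  opt_spec _ I.capacity_pos.le

theorem le_bestIndividual {a : ℕ} (ha : a ∈ Finset.Icc 1 I.n) {D : Finset (Item ι)}
    (hD : D ⊆ ownedBy a I.items) (hs : totalSize D ≤ I.capacity) :
    totalValue D ≤ totalValue (bestIndividual I) :=
  (le_opt hD hs).trans ((bestAgent_spec I).2 a ha)

theorem noLargeBundle_of_lt (hI : I ∈ unitDensity ι)
    (h : totalValue (bestIndividual I) < 2 / 3 * I.capacity) :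
    NoLargeBundle I.items I.capacity where
  toUnitItems := unitItems_of_mem hI
  capacity_pos := I.capacity_pos
  le_capacity i hi := by
    rw [← (unitItems_of_mem hI).size_eq i hi]
    exact I.size_le_capacity i hi
  bundle_lt a D hD hs := by
    -- The index `a` is arbitrary; only a nonempty bundle shows that it is an actual agent.
    rcases D.eq_empty_or_nonempty with rfl | ⟨i, hi⟩
    · rw [totalValue_empty]
      linarith [I.capacity_pos]
    · obtain ⟨hiI, rfl⟩ := mem_ownedBy.1 (hD hi)
      have hsize := ((unitItems_of_mem hI).mono (hD.trans (ownedBy_subset _ _))).totalSize_eq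
      exact (le_bestIndividual (I.owner_mem i hiI) hD (hsize.trans_le hs)).trans_lt h

/-- Distinct feasible sets of a unit-density instance have distinct values. -/
theorem eq_of_totalValue_eq (hI : I ∈ unitDensity ι) {D D' : Finset (Item ι)}
    (hD : D ⊆ I.items) (hD' : D' ⊆ I.items) (hs : totalValue D ≤ I.capacity)
    (h : totalValue D = totalValue D') : D = D' := by
  have hU := unitItems_of_mem hI
  -- For capacity v(D), a set of value v(D) fills the knapsack exactly and is therefore optimal.
  have hopt : ∀ F ⊆ I.items, totalValue F = totalValue D →
      IsOptimal I.items (totalValue D) F := fun F hF hFD =>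
    ⟨⟨hF, ((hU.mono hF).totalSize_eq.trans hFD).le⟩, fun G hG hGs => by
      rwa [(hU.mono hG).totalSize_eq, ← hFD] at hGs⟩
  exact (I.unique_optimal I.items subset_rfl _ (hU.mono hD).totalValue_nonneg hs).unique
    (hopt D hD rfl) (hopt D' hD' h.symm)

/-- Return the best individual optimum if it fills two thirds of the capacity, and otherwise run
`RestrictedGreedy` on the set `Q I`. -/
noncomputable def thresholdGreedy (Q : KnapsackInstance ι → Finset (Item ι))
    (I : KnapsackInstance ι) : Finset (Item ι) :=
  if 2 / 3 * I.capacity ≤ totalValue (bestIndividual I) then bestIndividual I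
  else restrictedGreedy I.n I.items (Q I) I.capacity

theorem thresholdGreedy_feasible {Q : KnapsackInstance ι → Finset (Item ι)}
    (hQ : ∀ I, Q I ⊆ I.items) (hI : I ∈ unitDensity ι) :
    thresholdGreedy Q I ⊆ I.items ∧ totalSize (thresholdGreedy Q I) ≤ I.capacity := by
  have hU := unitItems_of_mem hI
  rw [thresholdGreedy]
  split_ifs
  · exact ⟨(bestIndividual_spec I).1.trans (ownedBy_subset _ _), (bestIndividual_spec I).2⟩
  · have hsub := (hU.mono (hQ I)).restrictedGreedy_subset I.n I.items I.capacity
    refine ⟨hsub, ?_⟩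
    rw [(hU.mono hsub).totalSize_eq]
    exact hU.totalValue_restrictedGreedy_le (hQ I) I.owner_mem I.capacity_pos.le

open scoped Classical in
/-- The deterministic mechanism that runs `thresholdGreedy` on unit-density instances. -/
noncomputable def thresholdMechanism (Q : KnapsackInstance ι → Finset (Item ι))
    (hQ : ∀ I, Q I ⊆ I.items) : DeterministicMechanism ι where
  -- Quotas bound values, not sizes, so beyond unit density the greedy output might be infeasible;
  -- the empty set is safe.
  output I := if I ∈ unitDensity ι then thresholdGreedy Q I else ∅
  feasible I := by
    split_ifs with hI
    · exact thresholdGreedy_feasible hQ hI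
    · exact ⟨Finset.empty_subset _, I.capacity_pos.le⟩

theorem thresholdMechanism_output {Q : KnapsackInstance ι → Finset (Item ι)}
    (hQ : ∀ I, Q I ⊆ I.items) (hI : I ∈ unitDensity ι) :
    (thresholdMechanism Q hQ).output I = thresholdGreedy Q I :=
  if_pos hI

theorem ownedBy_of_subset {a : ℕ} {E D : Finset (Item ι)} (h : D ⊆ ownedBy a E) :
    ownedBy a D = D :=
  Finset.filter_true_of_mem fun _ hi => (mem_ownedBy.1 (h hi)).2

theorem ownedBy_of_subset_of_ne {a b : ℕ} {E D : Finset (Item ι)} (h : D ⊆ ownedBy b E)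
    (hab : b ≠ a) : ownedBy a D = ∅ :=
  Finset.filter_false_of_mem fun _ hi => (mem_ownedBy.1 (h hi)).2 ▸ hab

/-- The threshold test is common to both mechanisms and is settled here, leaving only the greedy
case to `hmono`. -/
theorem thresholdMechanism_strategyproofOn {Q : KnapsackInstance ι → Finset (Item ι)}
    (hQ : ∀ I, Q I ⊆ I.items)
    (hmono : ∀ (I : KnapsackInstance ι) (a : ℕ) (E' : Finset (Item ι)) (h : E' ⊆ I.items),
      NoLargeBundle I.items I.capacity → I.items \ E' ⊆ ownedBy a I.items →
      totalValue (bestBundle a E' (quota a (Q (I.restrict E' h)) I.capacity)) ≤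
        totalValue (bestBundle a I.items (quota a (Q I) I.capacity))) :
    (thresholdMechanism Q hQ).StrategyproofOn (unitDensity ι) := by
  intro I hI a ha E' h hhide
  have hI' := restrict_mem_unitDensity hI h
  set I' := I.restrict E' h
  have hitems : I'.items = E' := rfl
  have hU := unitItems_of_mem hI
  have hU' := unitItems_of_mem hI'
  have hfeas' := thresholdGreedy_feasible hQ hI'
  rw [thresholdMechanism_output hQ hI, thresholdMechanism_output hQ hI']
  have hkeep : ∀ b ≠ a, ownedBy b E' = ownedBy b I.items := fun b hb => by
    refine (ownedBy_mono b h).antisymm fun i hi => ?_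
    obtain ⟨hiI, hib⟩ := mem_ownedBy.1 hi
    refine mem_ownedBy.2 ⟨?_, hib⟩
    by_contra hiE
    exact hb (hib.symm.trans (mem_ownedBy.1 (hhide (Finset.mem_sdiff.2 ⟨hiI, hiE⟩))).2)
  have hbest := bestIndividual_spec I
  have hbest' := bestIndividual_spec I'
  by_cases hlarge : 2 / 3 * I.capacity ≤ totalValue (bestIndividual I)
  · have hout : thresholdGreedy Q I = bestIndividual I := if_pos hlarge
    rw [hout]
    by_cases hb : bestAgent I = a
    · have hself : ownedBy a (bestIndividual I) = bestIndividual I :=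
        ownedBy_of_subset (hb ▸ hbest.1)
      rw [hself]
      have hsub := ownedBy_subset a (thresholdGreedy Q I')
      refine le_bestIndividual ha (ownedBy_mono a (hfeas'.1.trans h)) ?_
      rw [((hU'.mono (hsub.trans hfeas'.1))).totalSize_eq]
      refine ((hU'.mono hfeas'.1).totalValue_mono hsub).trans ?_
      rw [← (hU'.mono hfeas'.1).totalSize_eq]
      exact hfeas'.2
    · have hbI' : totalValue (bestIndividual I) ≤ totalValue (bestIndividual I') :=
        le_bestIndividual (I := I') (bestAgent_spec I).1
          (by rw [hitems, hkeep _ hb]; exact hbest.1) hbest.2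
      have hout' : thresholdGreedy Q I' = bestIndividual I' := if_pos (hlarge.trans hbI')
      rw [hout']
      -- Were `a` to win by hiding, its bundle would tie with that of the old winner. Equal values
      -- force equal sets, so a set with two owners, which is empty and misses the threshold.
      have hb' : bestAgent I' ≠ a := fun hb' => by
        have hsub' : bestIndividual I' ⊆ ownedBy a I.items :=
          (hb' ▸ hbest'.1).trans (ownedBy_mono a h)
        have heq := eq_of_totalValue_eq hI (hsub'.trans (ownedBy_subset _ _))
          (hbest.1.trans (ownedBy_subset _ _))
          (by rw [← (hU.mono (hsub'.trans (ownedBy_subset _ _))).totalSize_eq]; exact hbest'.2)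
          (le_antisymm (le_bestIndividual ha hsub' hbest'.2) hbI')
        have hempty : bestIndividual I = ∅ := by
          have hself : ownedBy a (bestIndividual I) = bestIndividual I :=
            ownedBy_of_subset (heq ▸ hsub')
          rw [← hself, ownedBy_of_subset_of_ne hbest.1 hb]
        rw [hempty, totalValue_empty] at hlarge
        linarith [I.capacity_pos]
      rw [ownedBy_of_subset_of_ne hbest'.1 hb', totalValue_empty]
      exact (hU.mono ((ownedBy_subset _ _).trans
        (hbest.1.trans (ownedBy_subset _ _)))).totalValue_nonneg
  · have hle : totalValue (bestIndividual I') ≤ totalValue (bestIndividual I) :=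
      le_bestIndividual (I := I) (bestAgent_spec I').1
        (hbest'.1.trans (ownedBy_mono _ h)) hbest'.2
    have hout : thresholdGreedy Q I = restrictedGreedy I.n I.items (Q I) I.capacity :=
      if_neg hlarge
    have hout' : thresholdGreedy Q I' = restrictedGreedy I.n E' (Q I') I.capacity :=
      if_neg fun hcon => hlarge (hcon.trans hle)
    rw [hout, hout', (hU.mono (hQ I)).ownedBy_restrictedGreedy ha,
      (hU'.mono (hQ I')).ownedBy_restrictedGreedy ha]
    exact hmono I a E' h (noLargeBundle_of_lt hI (not_le.1 hlarge)) hhide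

/-- The least valuable item fits vacuously, so the maximum over `fitSet I` exists. -/
theorem exists_restrictedSet_eq (h : I.items.Nonempty) :
    ∃ p, IsTopFit I.items I.capacity p ∧
      restrictedSet I = compatible I.items I.capacity p := by
  have hmem : ∀ i, i ∈ fitSet I ↔ i ∈ I.items ∧ Fits I.items I.capacity i :=
    fun i => Finset.mem_filter
  have hne : (fitSet I).Nonempty := by
    obtain ⟨m, hm, hmin⟩ := I.items.exists_min_image Item.value h
    exact ⟨m, (hmem m).2 ⟨hm, fun j hj _ hlt => absurd (hmin j hj) hlt.not_ge⟩⟩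
  have hspec := Classical.choose_spec ((fitSet I).exists_max_image Item.value hne)
  obtain ⟨hp, hfits⟩ := (hmem _).1 hspec.1
  refine ⟨_, ⟨hp, hfits, fun i hi hif => hspec.2 i ((hmem i).2 ⟨hi, hif⟩)⟩, ?_⟩
  rw [restrictedSet, dif_pos hne]
  rfl

theorem exists_largeSet_eq (h : I.items.Nonempty) :
    ∃ j, IsTop I.items j ∧ largeSet I = ownOrCompatible I.items I.capacity j := by
  have hspec := Classical.choose_spec (I.items.exists_max_image Item.value h)
  refine ⟨_, ⟨hspec.1, hspec.2⟩, ?_⟩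
  rw [largeSet, dif_pos h]
  rfl

theorem restrictedSet_subset (I : KnapsackInstance ι) : restrictedSet I ⊆ I.items := by
  rcases I.items.eq_empty_or_nonempty with h | h
  · have hne : ¬ (fitSet I).Nonempty := fun ⟨i, hi⟩ =>
      Finset.notMem_empty i (h ▸ (Finset.mem_filter.1 hi).1)
    rw [restrictedSet, dif_neg hne]
    exact Finset.empty_subset _
  · obtain ⟨p, hp, heq⟩ := exists_restrictedSet_eq h
    rw [heq]
    exact compatible_subset hp.mem

theorem largeSet_subset (I : KnapsackInstance ι) : largeSet I ⊆ I.items := by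
  rcases I.items.eq_empty_or_nonempty with h | h
  · rw [largeSet, dif_neg (Finset.not_nonempty_iff_eq_empty.2 h)]
    exact Finset.empty_subset _
  · obtain ⟨j, -, heq⟩ := exists_largeSet_eq h
    rw [heq]
    exact ownOrCompatible_subset

end

variable (ι) in
/-- `FitTwo` with parameter `2/3`, as a deterministic mechanism. -/
noncomputable def fitTwoMechanism : DeterministicMechanism ι :=
  thresholdMechanism restrictedSet restrictedSet_subset

variable (ι) in
/-- `LargeFit` as a deterministic mechanism. -/
noncomputable def largeFitMechanism : DeterministicMechanism ι :=
  thresholdMechanism largeSet largeSet_subset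

variable {I : KnapsackInstance ι}

theorem fitTwoMechanism_output (hI : I ∈ unitDensity ι) :
    (fitTwoMechanism ι).output I = fitTwo (2 / 3) I :=
  thresholdMechanism_output restrictedSet_subset hI

theorem largeFitMechanism_output (hI : I ∈ unitDensity ι) :
    (largeFitMechanism ι).output I = largeFit I :=
  thresholdMechanism_output largeSet_subset hI

theorem totalValue_bestBundle_empty {a : ℕ} {E : Finset (Item ι)} {Q Q' : Finset (Item ι)}
    {C : ℝ} (hE : UnitItems E) (hQ' : Q' ⊆ (∅ : Finset (Item ι))) (hQ : Q ⊆ E) :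
    totalValue (bestBundle a (∅ : Finset (Item ι)) (quota a Q' C)) ≤ totalValue (bestBundle a E (quota a Q C)) :=
  bestBundle_mono (Finset.empty_subset _) ((hE.mono
    (hQ'.trans (Finset.empty_subset _))).quota_nonneg a C) (by
      rw [Finset.subset_empty.1 hQ']
      exact (hE.mono hQ).quota_nonneg a C)

theorem fitTwoMechanism_strategyproofOn :
    (fitTwoMechanism ι).StrategyproofOn (unitDensity ι) := by
  refine thresholdMechanism_strategyproofOn _ fun I a E' h hE hhide => ?_
  have hsub' := restrictedSet_subset (I.restrict E' h)
  rcases E'.eq_empty_or_nonempty with rfl | hne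
  · exact totalValue_bestBundle_empty hE.toUnitItems hsub' (restrictedSet_subset I)
  · obtain ⟨p, hp, heq⟩ := exists_restrictedSet_eq (hne.mono h)
    obtain ⟨p', hp', heq'⟩ := exists_restrictedSet_eq (I := I.restrict E' h) hne
    rw [heq, heq']
    exact hE.bestBundle_compatible_le h hhide hp hp'

theorem largeFitMechanism_strategyproofOn :
    (largeFitMechanism ι).StrategyproofOn (unitDensity ι) := by
  refine thresholdMechanism_strategyproofOn _ fun I a E' h hE hhide => ?_
  have hsub' := largeSet_subset (I.restrict E' h)
  rcases E'.eq_empty_or_nonempty with rfl | hne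
  · exact totalValue_bestBundle_empty hE.toUnitItems hsub' (largeSet_subset I)
  · obtain ⟨j, hj, heq⟩ := exists_largeSet_eq (hne.mono h)
    obtain ⟨j', hj', heq'⟩ := exists_largeSet_eq (I := I.restrict E' h) hne
    rw [heq, heq']
    exact hE.bestBundle_ownOrCompatible_le h hhide hj hj'

theorem two_mul_opt_le (hI : I ∈ unitDensity ι) :
    2 * totalValue (opt I.items I.capacity) ≤
      2 * totalValue (fitTwo (2 / 3) I) + totalValue (largeFit I) := by
  have hU := unitItems_of_mem hI
  obtain ⟨hOE, hOC⟩ := opt_spec I.items I.capacity_pos.le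
  rw [(hU.mono hOE).totalSize_eq] at hOC
  rw [fitTwo, largeFit]
  split_ifs with h
  · linarith
  · have hE := noLargeBundle_of_lt hI (not_le.1 h)
    rcases I.items.eq_empty_or_nonempty with hemp | hne
    · have hfit := (hU.mono ((hU.mono (restrictedSet_subset I)).restrictedGreedy_subset I.n
        I.items I.capacity)).totalValue_nonneg
      have hlarge := (hU.mono ((hU.mono (largeSet_subset I)).restrictedGreedy_subset I.n
        I.items I.capacity)).totalValue_nonneg
      have hO : opt I.items I.capacity = ∅ := Finset.subset_empty.1 (hemp ▸ hOE)
      rw [hO, totalValue_empty]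
      linarith
    · obtain ⟨p, hp, heq⟩ := exists_restrictedSet_eq hne
      obtain ⟨j, hj, heq'⟩ := exists_largeSet_eq hne
      rw [heq, heq']
      exact hE.two_mul_totalValue_le I.owner_mem hp hj hOE hOC

/-! ### The lottery -/

variable (ι) in
/-- The lottery that runs `FitTwo` with probability `2/3` and `LargeFit` otherwise. -/
noncomputable def fitLottery : PMF (DeterministicMechanism ι) :=
  coin.map (fun X => if X = true then fitTwoMechanism ι else largeFitMechanism ι)

variable (ι) in
/-- The randomized mechanism induced by `fitLottery`. -/
noncomputable def fitMechanism : RandomizedMechanism ι where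
  law I := (fitLottery ι).map (fun F => F.output I)
  feasible I D hD := by
    obtain ⟨F, -, rfl⟩ := (PMF.mem_support_map_iff _ _ _).1 hD
    exact F.feasible I

theorem fitMechanism_law (hI : I ∈ unitDensity ι) :
    (fitMechanism ι).law I = randomizedFit I := by
  change ((coin.map _).map _) = coin.map _
  rw [PMF.map_comp]
  congr 1
  funext X
  cases X
  · exact largeFitMechanism_output hI
  · exact fitTwoMechanism_output hI

theorem fitMechanism_strategyproofOn : (fitMechanism ι).StrategyproofOn (unitDensity ι) := by
  refine ⟨fitLottery ι, fun F hF => ?_, fun I => rfl⟩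
  obtain ⟨X, -, rfl⟩ := (PMF.mem_support_map_iff _ _ _).1 hF
  split_ifs
  · exact fitTwoMechanism_strategyproofOn
  · exact largeFitMechanism_strategyproofOn

-- Two separate indicators are needed because the two outputs may coincide.
open scoped ENNReal in
theorem randomizedFit_toReal (I : KnapsackInstance ι) (D : Finset (Item ι)) :
    (randomizedFit I D).toReal =
      (if D = fitTwo (2 / 3) I then 2 / 3 else 0) + (if D = largeFit I then 1 / 3 else 0) := by
  have h2 : coin true = (2 / 3 : ℝ≥0∞) := rfl
  have h1 : coin false = (1 / 3 : ℝ≥0∞) := rfl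
  have hfin : ∀ (P : Prop) [Decidable P] (q r : ℝ≥0∞), r ≠ 0 → q ≠ ∞ →
      (if P then q / r else 0) ≠ ∞ := fun P _ q r hr hq => by
    split_ifs
    exacts [ENNReal.div_ne_top hq hr, ENNReal.zero_ne_top]
  rw [randomizedFit, PMF.map_apply, tsum_bool, h1, h2, add_comm]
  simp only [if_true, Bool.false_eq_true, if_false]
  rw [ENNReal.toReal_add (hfin _ _ _ (by norm_num) (by norm_num))
    (hfin _ _ _ (by norm_num) (by norm_num))]
  split_ifs <;> simp

theorem fitMechanism_expectedValue (hI : I ∈ unitDensity ι) :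
    (fitMechanism ι).expectedValue I =
      2 / 3 * totalValue (fitTwo (2 / 3) I) + 1 / 3 * totalValue (largeFit I) := by
  have hfit : fitTwo (2 / 3) I ∈ I.items.powerset :=
    Finset.mem_powerset.2 (thresholdGreedy_feasible restrictedSet_subset hI).1
  have hlarge : largeFit I ∈ I.items.powerset :=
    Finset.mem_powerset.2 (thresholdGreedy_feasible largeSet_subset hI).1
  simp only [RandomizedMechanism.expectedValue, fitMechanism_law hI, randomizedFit_toReal,
    add_mul, ite_mul, zero_mul, Finset.sum_add_distrib, Finset.sum_ite_eq', hfit, hlarge, if_true]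

theorem fitMechanism_approximateOn :
    (fitMechanism ι).ApproximateOn (2 / 3) (unitDensity ι) := by
  intro I hI
  rw [fitMechanism_expectedValue hI]
  linarith [two_mul_opt_le hI]

end StrategicKnapsack

theorem mainTheorem5 (ι : Type*) :
    ∃ M : StrategicKnapsack.RandomizedMechanism ι,
      (∀ I ∈ StrategicKnapsack.unitDensity ι, M.law I = StrategicKnapsack.randomizedFit I) ∧
        M.StrategyproofOn (StrategicKnapsack.unitDensity ι) ∧
          M.ApproximateOn (2 / 3) (StrategicKnapsack.unitDensity ι) :=
  ⟨StrategicKnapsack.fitMechanism ι, fun _ hI => StrategicKnapsack.fitMechanism_law hI,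
    StrategicKnapsack.fitMechanism_strategyproofOn, StrategicKnapsack.fitMechanism_approximateOn⟩
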